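/- Let $G$ be a finite-dimensional real Lie group with identity $e$ and Lie algebra $\mathfrak g$, and identify $T_gG$ with $\mathfrak g$ by left translation, so that the differential of a function $f:G\to\mathbb R$ becomes a map $df:G\to\mathfrak g^*$, $\langle df(g),a\rangle=\frac{d}{dt}\big|_{t=0}f(g\exp(ta))$. Write $\mathrm{Ad}^*_g:\mathfrak g^*\to\mathfrak g^*$ for the transpose of $\mathrm{Ad}_g$. Let $K:G\to\mathbb R$ be $C^2$ with $dK(e)=0$ and such that the map of manifolds $dK:G\to\mathfrak g^*$ has full rank at $e$. For a $C^2$ function $\varphi:G\to\mathbb R$, a step size $h>0$, an integer $n\ge0$, an initial state $g_0\in G$ and a kinetic function $\mathsf K:G\to\mathbb R$ (below $\mathsf K=K$, or $\mathsf K=sK$ with $s>0$) put, for $\mathbf u=(u_0,\dots,u_{n-1})\in G^n$, $g_{i+1}=g_iu_i$ and $$J(\mathbf u)=\sum_{i=0}^{n-1}L(g_i,u_i),\qquad L(g,u)=h\mathsf K(u)-\tfrac h2\varphi(g)-\tfrac h2\varphi(gu).$$ Call $\mathbf u$ critical if the lower Dini derivative of $J$ at $\mathbf u$ is nonnegative in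 every direction of $T_{\mathbf u}G^n$. Put $p_i=d_uL(g_{i-1},u_{i-1})\in\mathfrak g^*$ for $1\le i\le n$ and $m_i=d\varphi(g_i)$. For $(g,p)\in G\times\mathfrak g^*$ say that $(u,g',p')\in G\times G\times\mathfrak g^*$ is a step of the integrator from $(g,p)$ if $$p=h\Big(\mathrm{Ad}^*_{u^{-1}}d\mathsf K(u)+\tfrac12\,d\varphi(g)\Big),\qquad g'=gu,\qquad p'=\mathrm{Ad}^*_{u}\,p-\tfrac h2\mathrm{Ad}^*_{u}\,d\varphi(g)-\tfrac h2\,d\varphi(g').$$ Then: 1. For all $\varphi,n,g_0,h>0$ and every $\mathbf u$ critical for $J$ with $\mathsf K=K$, the triple $(u_i,g_{i+1},p_{i+1})$ is a step of the integrator from $(g_i,p_i)$ for $1\le i\le n-1$; that is, $$p_i=h\big(\mathrm{Ad}^*_{u_i^{-1}}dK(u_i)+\tfrac12m_i\big),\quad g_{i+1}=g_iu_i,\quad p_{i+1}=\mathrm{Ad}^*_{u_i}p_i-\tfrac h2\mathrm{Ad}^*_{u_i}m_i-\tfrac h2m_{i+1}.$$ Moreover there are open neighbourhoods $N$ of $e$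 in $G$ and $V$ of $0$ in $\mathfrak g^*$, depending only on $K$, such that for every $C^2$ function $\varphi$ the following hold. 2. For all $h,s>0$, with $\mathsf K=sK$, and all $(g,p)$ with $\frac1{hs}\big(p-\frac h2d\varphi(g)\big)\in V$, there is exactly one step $(u,g',p')$ of the integrator from $(g,p)$ with $u\in N$. 3. For all $n,g_0$ and $h,s>0$, if $\mathbf u$ is critical for $J$ with $\mathsf K=sK$, $1\le i\le n-1$ and $u_i\in N$, then $(u_i,g_{i+1},p_{i+1})$ is the only step of the integrator from $(g_i,p_i)$ whose first component lies in $N$. 4. (Small step size.) Let $s(h)$ be real numbers, positive for all sufficiently small $h>0$, and take $\mathsf K=s(h)K$ ($s\equiv1$ being the case of a fixed kinetic function). (a) If $(g(h),p(h))\in G\times\mathfrak g^*$ satisfy $\frac1{h\,s(h)}\big(p(h)-\frac h2d\varphi(g(h))\big)\to0$ as $h\downarrow0$, then for all sufficiently small $h>0$ there is exactly one step $(u,g',p')$ of the integrator from $(g(h),p(h))$ with $u\in N$. (b) If $n$ and $g_0$ are fixed, $\mathbf u(h)$ is critical for $J$ for all sufficiently small $h>0$, $1\le i\le n-1$ and $u_i(h)\to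 e$ as $h\downarrow0$, then for all sufficiently small $h>0$ the triple $(u_i(h),g_{i+1}(h),p_{i+1}(h))$ is the only step of the integrator from $(g_i(h),p_i(h))$ whose first component lies in $N$. -/

import Mathlib

open Filter
open scoped Manifold ContDiff Topology

noncomputable section

section LieGroupCalculus

variable {E : Type*} [NormedAddCommGroup E] [NormedSpace ℝ E]
  {G : Type*} [TopologicalSpace G] [ChartedSpace E G] [Group G]

/-- The Lie algebra of a Lie group modelled on `E` is the tangent space at the identity,
`TangentSpace 𝓘(ℝ, E) (1 : G)`, which in Mathlib is by definition the model space `E`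
(read in the preferred chart at the identity). We use `E` itself, because it carries a norm. -/
abbrev LieAlg (E : Type*) [NormedAddCommGroup E] : Type _ := E

/-- The dual of the Lie algebra. -/
abbrev LieCoalg (E : Type*) [NormedAddCommGroup E] [NormedSpace ℝ E] : Type _ :=
  LieAlg E →L[ℝ] ℝ

/-- The differential of `f : G → ℝ` at `g`, as an element of the dual of the Lie algebra through
the left trivialization `T_g G = {DL_g a : a ∈ 𝔤}`: it sends `a` to `⟨df(g), DL_g a⟩`. -/
def leftDifferential (f : G → ℝ) (g : G) : LieCoalg E :=
  (mfderiv 𝓘(ℝ, E) 𝓘(ℝ, ℝ) (fun x : G => f (g * x)) 1 : E →L[ℝ] ℝ)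

/-- The adjoint representation: `Ad_g` is the differential at the identity of
`x ↦ g x g⁻¹`. -/
def adjointRep (g : G) : LieAlg E →L[ℝ] LieAlg E :=
  (mfderiv 𝓘(ℝ, E) 𝓘(ℝ, E) (fun x : G => g * x * g⁻¹) 1 : E →L[ℝ] E)

/-- `Ad^*_g = (Ad_g)^*`, the transpose of `Ad_g`. -/
def coadjoint (g : G) (p : LieCoalg E) : LieCoalg E := p.comp (adjointRep g)

/-- The map of manifolds `dK : G → 𝔤^*` has full rank at the identity. -/
def DifferentialFullRankAtOne (E : Type*) [NormedAddCommGroup E] [NormedSpace ℝ E]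
    {G : Type*} [TopologicalSpace G] [ChartedSpace E G] [Group G] (K : G → ℝ) : Prop :=
  Module.finrank ℝ (LinearMap.range
    (mfderiv 𝓘(ℝ, E) 𝓘(ℝ, LieCoalg E)
      (fun g : G => (leftDifferential K g : LieCoalg E)) 1 : E →L[ℝ] LieCoalg E).toLinearMap)
    = Module.finrank ℝ E

end LieGroupCalculus

section CriticalControls

/-- The lower Dini derivative at time `0` of `J` along a curve `c` of control sequences. -/
def lowerDini {G : Type*} {n : ℕ} (J : (Fin n → G) → ℝ) (c : ℝ → Fin n → G) : EReal :=
  liminf (fun t : ℝ => (((J (c t) - J (c 0)) / t : ℝ) : EReal)) (𝓝[>] (0 : ℝ))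

/-- `u ∈ Gⁿ` is critical for `J` when the lower Dini derivative of `J` at `u` is nonnegative in
every tangent direction, the directions being represented by smooth curves through `u`. (All of
`Gⁿ` is admissible, so the tangent cone to the control set is the whole tangent space.) -/
def IsCriticalControl (E : Type*) [NormedAddCommGroup E] [NormedSpace ℝ E]
    {G : Type*} [TopologicalSpace G] [ChartedSpace E G] {n : ℕ}
    (J : (Fin n → G) → ℝ) (u : Fin n → G) : Prop :=
  ∀ c : ℝ → Fin n → G,
    (∀ i, ContMDiff 𝓘(ℝ, ℝ) 𝓘(ℝ, E) ∞ (fun t => c t i)) → c 0 = u → 0 ≤ lowerDini J c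

end CriticalControls

section Integrator

variable {G : Type*} [Group G]

/-- The states `g_0, …, g_n` with `g_{i+1} = g_i u_i`. -/
def stateSeq {n : ℕ} (g₀ : G) (u : Fin n → G) : Fin (n + 1) → G :=
  Fin.induction g₀ (fun i g => g * u i)

/-- The discrete Lagrangian `L(g, u) = h K(u) - (h/2) φ(g) - (h/2) φ(gu)`. -/
def discreteLagrangian (h : ℝ) (K φ : G → ℝ) (g u : G) : ℝ :=
  h * K u - h / 2 * φ g - h / 2 * φ (g * u)

/-- The action sum, as a function of the control sequence, for the initial state `g₀`. -/
def actionSum {n : ℕ} (g₀ : G) (h : ℝ) (K φ : G → ℝ) (u : Fin n → G) : ℝ :=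
  ∑ i : Fin n, discreteLagrangian h K φ (stateSeq g₀ u i.castSucc) (u i)

variable {E : Type*} [NormedAddCommGroup E] [NormedSpace ℝ E]
  [TopologicalSpace G] [ChartedSpace E G]

/-- The discrete Legendre transform `𝔽⁺L(g, u) = d_u L(g, u) ∈ 𝔤^*`. -/
def discreteLegendre (L : G → G → ℝ) (g u : G) : LieCoalg E := leftDifferential (L g) u

/-- The discrete momenta `p_i = 𝔽⁺L(g_{i-1}, u_{i-1})` for `1 ≤ i ≤ n`. There is no momentum
`p_0`; the entry with index `0` is a placeholder. -/
def momentumSeq {n : ℕ} (g₀ : G) (h : ℝ) (K φ : G → ℝ) (u : Fin n → G) :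
    Fin (n + 1) → LieCoalg E :=
  Fin.cases 0 (fun j => discreteLegendre (discreteLagrangian h K φ) (stateSeq g₀ u j.castSucc) (u j))

/-- The triple `x = (u, g', p')` solves the equations of one step of the integrator from
`(g, p)`, with `m = dφ(g)` and `m' = dφ(g')`:
`p = h (Ad^*_{u⁻¹} dK(u) + m / 2)`, `g' = g u`,
`p' = Ad^*_u p - (h/2) Ad^*_u m - (h/2) m'`. -/
def IsIntegratorStep (h : ℝ) (K φ : G → ℝ) (g : G) (p : LieCoalg E)
    (x : G × G × LieCoalg E) : Prop :=
  p = h • (coadjoint x.1⁻¹ (leftDifferential K x.1) + (1 / 2 : ℝ) • leftDifferential φ g) ∧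
  x.2.1 = g * x.1 ∧
  x.2.2 = coadjoint x.1 p - (h / 2) • coadjoint x.1 (leftDifferential φ g)
    - (h / 2) • leftDifferential φ x.2.1

end Integrator

end

/-! Criticality is tested on variations that replace consecutive controls `u_k, u_i` by `u_k x, x⁻¹
u_i`. Only the state between them moves, so two terms of the action change, and stationarity equates
`p_i` with the right-trivialized derivative of the second term
(`momentumSeq_succ_eq_of_isCriticalControl`). Applying `Ad^*_{u_i}` to this equation yields the
momentum update.

In a step, `g'` and `p'` are explicit once `u` is known, and the equation for `u` rescales to
`Ad^*_{u⁻¹} dK(u) = (p - (h/2) dφ(g)) / (hs)`, whose left side involves `K` alone. That left side is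
the differential of `K` in the right trivialization. In the chart at `1`, the left and right
differentials are the two partial differentials of `(y, x) ↦ K(y x)`, so by symmetry of second
derivatives their derivatives at `1` are transposes of each other. Full rank thus passes from `dK`
to `u ↦ Ad^*_{u⁻¹} dK(u)`, and the inverse function theorem gives a local homeomorphism `θ` whose
source and target serve as `N` and `V` (`exists_openPartialHomeomorph_coadjoint_leftDifferential`).
-/

/-! ### Symmetry of mixed second derivatives -/

section SecondDerivative

variable {E : Type*} [NormedAddCommGroup E] [NormedSpace ℝ E]

/-- The two mixed partial differentials of a `C²` function on `E × E` are transposes of each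
other. -/
theorem exists_hasStrictFDerivAt_partial_transpose {f : E × E → ℝ} {z : E}
    (hf : ContDiffAt ℝ 2 f (z, z)) :
    ∃ A B : E →L[ℝ] E →L[ℝ] ℝ,
      HasStrictFDerivAt (fun y => fderiv ℝ (fun x => f (y, x)) z) A z ∧
      HasStrictFDerivAt (fun y => fderiv ℝ (fun x => f (x, y)) z) B z ∧
      ∀ a b, B b a = A a b := by
  have hd : ∀ᶠ q in 𝓝 (z, z), DifferentiableAt ℝ f q := by
    filter_upwards [hf.eventually (by simp)] with q hq
    exact hq.differentiableAt (by simp)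
  have h1 : ContDiffAt ℝ 1 (fderiv ℝ f) (z, z) := hf.fderiv_right (by norm_num)
  have h2 : HasStrictFDerivAt (fderiv ℝ f) (fderiv ℝ (fderiv ℝ f) (z, z)) (z, z) :=
    h1.hasStrictFDerivAt (by simp)
  have hsymm : IsSymmSndFDerivAt ℝ f (z, z) := hf.isSymmSndFDerivAt (by simp)
  have hl : HasStrictFDerivAt (fun y : E => (y, z)) (ContinuousLinearMap.inl ℝ E E) z :=
    (hasStrictFDerivAt_id z).prodMk (hasStrictFDerivAt_const z z)
  have hr : HasStrictFDerivAt (fun y : E => (z, y)) (ContinuousLinearMap.inr ℝ E E) z :=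
    (hasStrictFDerivAt_const z z).prodMk (hasStrictFDerivAt_id z)
  have hA := (HasStrictFDerivAt.comp (f := fun y : E => (y, z)) z h2 hl).clm_comp
    (hasStrictFDerivAt_const (ContinuousLinearMap.inr ℝ E E) z)
  have hB := (HasStrictFDerivAt.comp (f := fun y : E => (z, y)) z h2 hr).clm_comp
    (hasStrictFDerivAt_const (ContinuousLinearMap.inl ℝ E E) z)
  -- The partial differentials are `fderiv ℝ f` composed with `inr` and `inl`; this holds only where
  -- `f` is differentiable, hence the equality near `z`.
  refine ⟨_, _, hA.congr_of_eventuallyEq ?_, hB.congr_of_eventuallyEq ?_, ?_⟩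
  · filter_upwards [hl.continuousAt.eventually hd] with y hy
    exact (HasFDerivAt.comp z hy.hasFDerivAt (hasFDerivAt_prodMk_right y z)).fderiv.symm
  · filter_upwards [hr.continuousAt.eventually hd] with y hy
    exact (HasFDerivAt.comp z hy.hasFDerivAt (hasFDerivAt_prodMk_left z y)).fderiv.symm
  · intro a b
    simpa using hsymm.eq (0, b) (a, 0)

end SecondDerivative

/-! ### Left and right trivializations, and the local inverse of the momentum map -/

section LieGroupCalculus

variable {E : Type*} [NormedAddCommGroup E] [NormedSpace ℝ E]
  {G : Type*} [TopologicalSpace G] [ChartedSpace E G] [Group G]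

theorem coadjoint_smul (g : G) (s : ℝ) (p : LieCoalg E) :
    coadjoint g (s • p) = s • coadjoint g p :=
  ContinuousLinearMap.smul_comp s p _

theorem coadjoint_add (g : G) (p q : LieCoalg E) :
    coadjoint g (p + q) = coadjoint g p + coadjoint g q :=
  ContinuousLinearMap.add_comp p q _

/-- Tangent vectors at `1` are read in this very chart, so no transition derivative appears. -/
theorem mfderiv_one_eq_fderiv_chart {F : Type*} [NormedAddCommGroup F] [NormedSpace ℝ F]
    {f : G → F} (hf : MDifferentiableAt 𝓘(ℝ, E) 𝓘(ℝ, F) f 1) :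
    (mfderiv 𝓘(ℝ, E) 𝓘(ℝ, F) f 1 : E →L[ℝ] F) =
      fderiv ℝ (fun z => f ((chartAt E (1 : G)).symm z)) (chartAt E (1 : G) 1) := by
  rw [hf.mfderiv]
  simp [writtenInExtChartAt, Function.comp_def, fderivWithin_univ, chartAt_self_eq]
  rfl

variable [LieGroup 𝓘(ℝ, E) ∞ G]

theorem mdifferentiableAt_comp_mul_left {f : G → ℝ} (hf : MDifferentiable 𝓘(ℝ, E) 𝓘(ℝ, ℝ) f)
    (g x : G) : MDifferentiableAt 𝓘(ℝ, E) 𝓘(ℝ, ℝ) (fun x => f (g * x)) x :=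
  (hf (g * x)).comp x ((contMDiff_mul_left (I := 𝓘(ℝ, E)) (n := ∞)).mdifferentiable (by simp) x)

theorem mdifferentiableAt_comp_mul_right {f : G → ℝ} (hf : MDifferentiable 𝓘(ℝ, E) 𝓘(ℝ, ℝ) f)
    (g x : G) : MDifferentiableAt 𝓘(ℝ, E) 𝓘(ℝ, ℝ) (fun x => f (x * g)) x :=
  (hf (x * g)).comp x ((contMDiff_mul_right (I := 𝓘(ℝ, E)) (n := ∞)).mdifferentiable (by simp) x)

theorem mdifferentiableAt_conj (g x : G) :
    MDifferentiableAt 𝓘(ℝ, E) 𝓘(ℝ, E) (fun x => g * x * g⁻¹) x :=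
  (((contMDiff_mul_right (I := 𝓘(ℝ, E)) (n := ∞) (a := g⁻¹)).comp
    (contMDiff_mul_left (a := g))).mdifferentiable (by simp) x)

/-- `Ad^*_{u⁻¹} df(u)` is the differential of `f` in the right trivialization. -/
theorem coadjoint_inv_leftDifferential {f : G → ℝ}
    (hf : MDifferentiable 𝓘(ℝ, E) 𝓘(ℝ, ℝ) f) (u : G) :
    coadjoint u⁻¹ (leftDifferential f u : LieCoalg E) =
      (mfderiv 𝓘(ℝ, E) 𝓘(ℝ, ℝ) (fun x : G => f (x * u)) 1 : E →L[ℝ] ℝ) := by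
  -- Right translation by `u` is left translation by `u` after conjugation by `u⁻¹`; the chain rule
  -- does the rest.
  have hfun : (fun x : G => f (x * u)) =
      (fun x => f (u * x)) ∘ (fun x => u⁻¹ * x * u⁻¹⁻¹) := by
    funext x; simp [mul_assoc]
  ext a
  rw [hfun]
  exact (mfderiv_comp_apply_of_eq (1 : G) (mdifferentiableAt_comp_mul_left hf u 1)
    (mdifferentiableAt_conj u⁻¹ 1) (by simp) a).symm

theorem adjointRep_inv_comp (g : G) :
    (adjointRep g⁻¹ : LieAlg E →L[ℝ] LieAlg E).comp (adjointRep g) =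
      ContinuousLinearMap.id ℝ E := by
  have hfun : (fun x : G => g⁻¹ * x * g⁻¹⁻¹) ∘ (fun x => g * x * g⁻¹) = id := by
    funext x; simp [mul_assoc]
  ext a
  have h := mfderiv_comp_apply_of_eq (1 : G) (mdifferentiableAt_conj (E := E) g⁻¹ 1)
    (mdifferentiableAt_conj (E := E) g 1) (by simp) a
  rw [hfun, mfderiv_id] at h
  exact h.symm

theorem coadjoint_coadjoint_inv (g : G) (p : LieCoalg E) :
    coadjoint g (coadjoint g⁻¹ p) = p := by
  rw [coadjoint, coadjoint, ContinuousLinearMap.comp_assoc, adjointRep_inv_comp,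
    ContinuousLinearMap.comp_id]

theorem leftDifferential_const_mul {f : G → ℝ} (hf : MDifferentiable 𝓘(ℝ, E) 𝓘(ℝ, ℝ) f)
    (s : ℝ) (g : G) :
    (leftDifferential (fun x => s * f x) g : LieCoalg E) = s • leftDifferential f g :=
  const_smul_mfderiv (mdifferentiableAt_comp_mul_left hf g 1) s

/-- The partial differentials of this function, with the differentiated variable at the identity,
are the left and right trivialized differentials of `K`. -/
theorem contDiffAt_mul_in_chart {K : G → ℝ} (hK : ContMDiff 𝓘(ℝ, E) 𝓘(ℝ, ℝ) 2 K) :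
    ContDiffAt ℝ 2 (fun q : E × E =>
      K ((chartAt E (1 : G)).symm q.1 * (chartAt E (1 : G)).symm q.2))
      (chartAt E (1 : G) 1, chartAt E (1 : G) 1) := by
  have : IsManifold 𝓘(ℝ, E) ∞ G := LieGroup.toContMDiffMul.toIsManifold
  have hψ : ContMDiffAt 𝓘(ℝ, E) 𝓘(ℝ, E) ∞ (chartAt E (1 : G)).symm (chartAt E (1 : G) 1) :=
    (contMDiffOn_chart_symm (I := 𝓘(ℝ, E)) (n := ∞) (x := (1 : G))).contMDiffAt
      ((chartAt E (1 : G)).open_target.mem_nhds (mem_chart_target E 1))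
  have h1 : ContMDiffAt 𝓘(ℝ, E × E) 𝓘(ℝ, E) ∞ (fun q : E × E => (chartAt E (1 : G)).symm q.1)
      (chartAt E (1 : G) 1, chartAt E (1 : G) 1) :=
    ContMDiffAt.comp (I' := 𝓘(ℝ, E)) _ hψ contDiffAt_fst.contMDiffAt
  have h2 : ContMDiffAt 𝓘(ℝ, E × E) 𝓘(ℝ, E) ∞ (fun q : E × E => (chartAt E (1 : G)).symm q.2)
      (chartAt E (1 : G) 1, chartAt E (1 : G) 1) :=
    ContMDiffAt.comp (I' := 𝓘(ℝ, E)) _ hψ contDiffAt_snd.contMDiffAt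
  have h3 := (h1.mul h2).of_le (m := 2) (by norm_cast)
  exact (hK.contMDiffAt.comp _ h3).contDiffAt

/-- If `dK` vanishes and has full rank at the identity, `u ↦ Ad^*_{u⁻¹} dK(u)` is a local
homeomorphism at the identity, onto a neighbourhood of `0`. -/
theorem exists_openPartialHomeomorph_coadjoint_leftDifferential [FiniteDimensional ℝ E]
    {K : G → ℝ} (hK : ContMDiff 𝓘(ℝ, E) 𝓘(ℝ, ℝ) 2 K)
    (hrank : DifferentialFullRankAtOne E K)
    (hzero : (leftDifferential K (1 : G) : LieCoalg E) = 0) :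
    ∃ θ : OpenPartialHomeomorph G (LieCoalg E), 1 ∈ θ.source ∧ 0 ∈ θ.target ∧
      ∀ u ∈ θ.source, θ u = coadjoint u⁻¹ (leftDifferential K u) := by
  have : IsManifold 𝓘(ℝ, E) ∞ G := LieGroup.toContMDiffMul.toIsManifold
  have : IsManifold 𝓘(ℝ, E) 1 G := IsManifold.of_le (n := ∞) (by exact_mod_cast le_top)
  have : CompleteSpace E := FiniteDimensional.complete ℝ E
  have hKd : MDifferentiable 𝓘(ℝ, E) 𝓘(ℝ, ℝ) K := hK.mdifferentiable (by simp)
  set ψ := chartAt E (1 : G) with hψ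
  obtain ⟨A, B, hA, hB, hAB⟩ := exists_hasStrictFDerivAt_partial_transpose
    (contDiffAt_mul_in_chart hK)
  simp only [← hψ] at hA hB
  have hleft : ∀ g : G, (leftDifferential K g : LieCoalg E) =
      fderiv ℝ (fun z => K (g * ψ.symm z)) (ψ 1) := fun g =>
    mfderiv_one_eq_fderiv_chart (mdifferentiableAt_comp_mul_left hKd g 1)
  have hright : ∀ g : G, coadjoint g⁻¹ (leftDifferential K g : LieCoalg E) =
      fderiv ℝ (fun z => K (ψ.symm z * g)) (ψ 1) := fun g =>
    (coadjoint_inv_leftDifferential hKd g).trans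
      (mfderiv_one_eq_fderiv_chart (mdifferentiableAt_comp_mul_right hKd g 1))
  have hsrc : (1 : G) ∈ ψ.source := mem_chart_source E 1
  have hmd : MDifferentiableAt 𝓘(ℝ, E) 𝓘(ℝ, LieCoalg E)
      (fun g : G => (leftDifferential K g : LieCoalg E)) 1 := by
    have h1 : MDifferentiableAt 𝓘(ℝ, E) 𝓘(ℝ, LieCoalg E)
        ((fun y => fderiv ℝ (fun x => K (ψ.symm y * ψ.symm x)) (ψ 1)) ∘ ψ) 1 :=
      MDifferentiableAt.comp (I' := 𝓘(ℝ, E)) (1 : G)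
        hA.hasFDerivAt.differentiableAt.mdifferentiableAt
        (mdifferentiableAt_atlas (chart_mem_atlas E 1) hsrc)
    refine h1.congr_of_eventuallyEq ?_
    filter_upwards [ψ.open_source.mem_nhds hsrc] with g hg
    simp only [Function.comp_apply, ψ.left_inv hg]
    exact hleft g
  have hAeq : (mfderiv 𝓘(ℝ, E) 𝓘(ℝ, LieCoalg E)
      (fun g : G => (leftDifferential K g : LieCoalg E)) 1 : E →L[ℝ] LieCoalg E) = A := by
    rw [mfderiv_one_eq_fderiv_chart hmd, ← hA.hasFDerivAt.fderiv]
    congr 1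
    funext y
    exact hleft _
  -- Since `𝔤` and `𝔤^*` have equal dimension, full rank means that `A` is surjective.
  have hfr : Module.finrank ℝ E = Module.finrank ℝ (E →L[ℝ] ℝ) :=
    (LinearMap.toContinuousLinearMap (𝕜 := ℝ) (E := E) (F' := ℝ)).finrank_eq ▸
      (Subspace.dual_finrank_eq (K := ℝ) (V := E)).symm
  have hAsurj : Function.Surjective A := by
    have h := hrank
    unfold DifferentialFullRankAtOne at h
    rw [hAeq, hfr] at h
    exact LinearMap.range_eq_top.1 (Submodule.eq_top_of_finrank_eq h)
  -- The transpose of a surjection is injective: if `B b = 0`, every functional `A a` kills `b`,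
  -- including one that attains the norm of `b`.
  have hBinj : Function.Injective B := by
    refine (injective_iff_map_eq_zero B).2 fun b hb => ?_
    by_contra hb0
    obtain ⟨l, -, hl⟩ := exists_dual_vector ℝ b (norm_ne_zero_iff.2 hb0)
    obtain ⟨a, ha⟩ := hAsurj l
    have := hAB a b
    rw [hb, ha, hl] at this
    exact hb0 (norm_eq_zero.1 this.symm)
  let e : E ≃L[ℝ] (E →L[ℝ] ℝ) :=
    (LinearMap.linearEquivOfInjective B.toLinearMap hBinj hfr).toContinuousLinearEquiv
  have he : (e : E →L[ℝ] (E →L[ℝ] ℝ)) = B := by ext; rfl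
  rw [← he] at hB
  let θ := ψ.trans (hB.toOpenPartialHomeomorph _)
  have h1 : (1 : G) ∈ θ.source := by
    rw [OpenPartialHomeomorph.trans_source]
    exact ⟨hsrc, hB.mem_toOpenPartialHomeomorph_source⟩
  have hθ : ∀ u ∈ θ.source, θ u = coadjoint u⁻¹ (leftDifferential K u) := by
    intro u hu
    rw [OpenPartialHomeomorph.trans_source] at hu
    rw [hright u, ← ψ.left_inv hu.1]
    simp [θ, ψ.left_inv hu.1]
  refine ⟨θ, h1, ?_, hθ⟩
  -- The vanishing of `dK` at the identity serves to place `0 = θ 1` in the target.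
  have h0 := θ.map_source h1
  rwa [hθ 1 h1, hzero, coadjoint, ContinuousLinearMap.zero_comp] at h0

end LieGroupCalculus

/-! ### Test curves through the identity -/

section Curves

variable {E : Type*} [NormedAddCommGroup E] [NormedSpace ℝ E]
  {G : Type*} [TopologicalSpace G] [ChartedSpace E G] [Group G] [LieGroup 𝓘(ℝ, E) ∞ G]

/-- On the diagonal `f (x * y⁻¹)` is constant, so its two partial derivatives at `(1, 1)` cancel. -/
theorem mfderiv_comp_inv_one {f : G → ℝ} (hf : MDifferentiable 𝓘(ℝ, E) 𝓘(ℝ, ℝ) f) (a : E) :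
    (mfderiv 𝓘(ℝ, E) 𝓘(ℝ, ℝ) (fun x : G => f x⁻¹) 1 : E →L[ℝ] ℝ) a =
      -(mfderiv 𝓘(ℝ, E) 𝓘(ℝ, ℝ) f 1 : E →L[ℝ] ℝ) a := by
  have hq : MDifferentiableAt (𝓘(ℝ, E).prod 𝓘(ℝ, E)) 𝓘(ℝ, E)
      (fun q : G × G => q.1 * q.2⁻¹) (1, 1) :=
    (contMDiff_fst.mul (contMDiff_snd.inv (n := ∞))).mdifferentiable (by simp) _
  have hF : MDifferentiableAt (𝓘(ℝ, E).prod 𝓘(ℝ, E)) 𝓘(ℝ, ℝ)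
      (fun q : G × G => f (q.1 * q.2⁻¹)) (1, 1) := (hf _).comp _ hq
  have hdiag : MDifferentiableAt 𝓘(ℝ, E) (𝓘(ℝ, E).prod 𝓘(ℝ, E)) (fun x : G => (x, x)) 1 :=
    mdifferentiableAt_id.prodMk mdifferentiableAt_id
  have h1 := mfderiv_comp_apply_of_eq (1 : G) hF hdiag rfl a
  have hconst : (fun q : G × G => f (q.1 * q.2⁻¹)) ∘ (fun x : G => (x, x)) = fun _ => f 1 := by
    funext x; simp
  have hd : mfderiv 𝓘(ℝ, E) (𝓘(ℝ, E).prod 𝓘(ℝ, E)) (fun x : G => (x, x)) 1 a = (a, a) := by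
    have := MDifferentiableAt.mfderiv_prod (mdifferentiableAt_id (I := 𝓘(ℝ, E)) (x := (1 : G)))
      (mdifferentiableAt_id (I := 𝓘(ℝ, E)) (x := (1 : G)))
    simp only [id] at this
    rw [this]
    simp [mfderiv_id]
    rfl
  rw [hconst, mfderiv_const, hd] at h1
  have h2 : (0 : ℝ) = (mfderiv 𝓘(ℝ, E) 𝓘(ℝ, ℝ) (fun x : G => f (x * 1⁻¹)) 1 : E →L[ℝ] ℝ) a +
      (mfderiv 𝓘(ℝ, E) 𝓘(ℝ, ℝ) (fun x : G => f (1 * x⁻¹)) 1 : E →L[ℝ] ℝ) a :=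
    h1.trans (mfderiv_prod_eq_add_apply (v := (a, a)) hF)
  have e1 : (fun x : G => f (x * 1⁻¹)) = f := by funext x; simp
  have e2 : (fun x : G => f (1 * x⁻¹)) = fun x => f x⁻¹ := by funext x; simp
  let D : (G → ℝ) → ℝ := fun F => (mfderiv 𝓘(ℝ, E) 𝓘(ℝ, ℝ) F 1 : E →L[ℝ] ℝ) a
  have h3 : 0 = D f + D fun x => f x⁻¹ :=
    h2.trans (congrArg₂ (· + ·) (congrArg D e1) (congrArg D e2))
  exact eq_neg_of_add_eq_zero_right h3.symm

/-- Criticality is tested on curves smooth on all of `ℝ`. A straight segment in the chart,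
reparametrized by a sine, stays in the chart for all time and has the right velocity at `0`. -/
theorem exists_contMDiff_curve_through_one (a : E) :
    ∃ x : ℝ → G, ContMDiff 𝓘(ℝ, ℝ) 𝓘(ℝ, E) ∞ x ∧ x 0 = 1 ∧
      ∀ f : G → ℝ, MDifferentiableAt 𝓘(ℝ, E) 𝓘(ℝ, ℝ) f 1 →
        HasDerivAt (fun t => f (x t)) ((mfderiv 𝓘(ℝ, E) 𝓘(ℝ, ℝ) f 1 : E →L[ℝ] ℝ) a) 0 := by
  have : IsManifold 𝓘(ℝ, E) ∞ G := LieGroup.toContMDiffMul.toIsManifold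
  have : IsManifold 𝓘(ℝ, E) 1 G := IsManifold.of_le (n := ∞) (by norm_cast)
  set ψ := chartAt E (1 : G) with hψ
  have hsrc : (1 : G) ∈ ψ.source := mem_chart_source E 1
  have htgt : ψ 1 ∈ ψ.target := mem_chart_target E 1
  obtain ⟨r, hr, hball⟩ := Metric.isOpen_iff.1 ψ.open_target (ψ 1) htgt
  -- This makes `ε * ‖a‖ < r`, also when `a = 0`; the function `ε sin(t/ε)` has derivative `1` at
  -- `0`.
  set ε : ℝ := r / (‖a‖ + 1) with hε
  have hna : 0 < ‖a‖ + 1 := by positivity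
  have hεpos : 0 < ε := by positivity
  let c : ℝ → E := fun t => ψ 1 + (ε * Real.sin (t / ε)) • a
  have hc : ContDiff ℝ ∞ c := by fun_prop
  have hct : ∀ t, c t ∈ ψ.target := by
    intro t
    apply hball
    rw [Metric.mem_ball, dist_eq_norm, add_sub_cancel_left, norm_smul, norm_mul,
      Real.norm_of_nonneg hεpos.le]
    calc ε * ‖Real.sin (t / ε)‖ * ‖a‖ ≤ ε * 1 * ‖a‖ := by
          gcongr
          exact Real.abs_sin_le_one _
      _ < ε * (‖a‖ + 1) := by nlinarith
      _ = r := by rw [hε]; field_simp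
  have hc0 : c 0 = ψ 1 := by simp [c]
  have hcd : HasDerivAt c a 0 := by
    have h1 : HasDerivAt (fun t : ℝ => t / ε) (1 / ε) 0 := (hasDerivAt_id 0).div_const ε
    have h2 := ((h1.sin.const_mul ε).smul_const a).const_add (ψ 1)
    convert h2 using 1
    simp [hεpos.ne']
  refine ⟨fun t => ψ.symm (c t), ?_, ?_, ?_⟩
  · exact (contMDiffOn_chart_symm (I := 𝓘(ℝ, E)) (n := ∞) (x := (1 : G))).comp_contMDiff
      hc.contMDiff hct
  · simp only [hc0]; exact ψ.left_inv hsrc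
  · intro f hf
    have hs : MDifferentiableAt 𝓘(ℝ, E) 𝓘(ℝ, E) ψ.symm (ψ 1) :=
      mdifferentiableAt_atlas_symm (chart_mem_atlas E 1) htgt
    have hf' : MDifferentiableAt 𝓘(ℝ, E) 𝓘(ℝ, ℝ) f (ψ.symm (ψ 1)) := by
      rwa [ψ.left_inv hsrc]
    have hd : DifferentiableAt ℝ (fun z => f (ψ.symm z)) (c 0) := by
      rw [hc0]; exact (hf'.comp _ hs).differentiableAt
    rw [mfderiv_one_eq_fderiv_chart hf, ← hψ, ← hc0]
    exact hd.hasFDerivAt.comp_hasDerivAt 0 hcd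

end Curves

/-! ### Critical controls and the discrete Euler–Lagrange equations -/

section Criticality

theorem nonneg_of_hasDerivAt_of_lowerDini_nonneg {G : Type*} {n : ℕ} {J : (Fin n → G) → ℝ}
    {c : ℝ → Fin n → G} {d : ℝ} (hd : HasDerivAt (fun t => J (c t)) d 0)
    (hJ : 0 ≤ lowerDini J c) : 0 ≤ d := by
  have h1 := hasDerivAt_iff_tendsto_slope_zero.1 hd
  have h2 : Tendsto (fun t : ℝ => (((J (c t) - J (c 0)) / t : ℝ) : EReal)) (𝓝[>] 0)
      (𝓝 (d : EReal)) := by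
    refine (continuous_coe_real_ereal.tendsto d).comp
      ((h1.mono_left (nhdsWithin_mono 0 fun t ht => ne_of_gt ht)).congr fun t => ?_)
    simp [div_eq_inv_mul]
  rw [lowerDini, h2.liminf_eq] at hJ
  exact_mod_cast hJ

/-- Replacing `u_k, u_{k+1}` by `u_k x, x⁻¹ u_{k+1}` moves only the state between them. -/
theorem stateSeq_update_update {G : Type*} [Group G] {n : ℕ} (g₀ x : G) (u : Fin n → G)
    {k i : Fin n} (hki : k.succ = i.castSucc) (j : Fin (n + 1)) :
    stateSeq g₀ (Function.update (Function.update u k (u k * x)) i (x⁻¹ * u i)) j =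
      if j = i.castSucc then stateSeq g₀ u j * x else stateSeq g₀ u j := by
  have hne : k ≠ i := by
    rintro rfl
    simp [Fin.ext_iff] at hki
  induction j using Fin.induction with
  | zero =>
    rw [if_neg]
    · rfl
    · rw [← hki]; exact (Fin.succ_ne_zero k).symm
  | succ j ih =>
    have hs : ∀ v : Fin n → G, stateSeq g₀ v j.succ = stateSeq g₀ v j.castSucc * v j :=
      fun v => rfl
    rw [hs, hs, ih, ← hki]
    -- At `j = i` the factor `x` in the state meets `x⁻¹` in the control, so later states are
    -- unchanged.
    by_cases hji : j = i
    · subst hji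
      simp [hki, mul_assoc, Fin.ext_iff]
    · have h1 : j.castSucc ≠ k.succ := by
        rw [hki]; exact fun h => hji (Fin.castSucc_injective n h)
      rw [if_neg h1, Function.update_of_ne hji]
      by_cases hjk : j = k
      · subst hjk
        simp [mul_assoc]
      · simp [hjk]

variable {E : Type*} [NormedAddCommGroup E] [NormedSpace ℝ E]
  {G : Type*} [TopologicalSpace G] [ChartedSpace E G] [Group G] [LieGroup 𝓘(ℝ, E) ∞ G]

theorem mdifferentiable_discreteLagrangian {K φ : G → ℝ}
    (hK : MDifferentiable 𝓘(ℝ, E) 𝓘(ℝ, ℝ) K) (hφ : MDifferentiable 𝓘(ℝ, E) 𝓘(ℝ, ℝ) φ)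
    (h : ℝ) (g : G) : MDifferentiable 𝓘(ℝ, E) 𝓘(ℝ, ℝ) (discreteLagrangian h K φ g) := fun x =>
  (((hK x).const_smul h).sub mdifferentiableAt_const).sub
    ((mdifferentiableAt_comp_mul_left hφ g x).const_smul (h / 2))

theorem discreteLegendre_discreteLagrangian {K φ : G → ℝ}
    (hK : MDifferentiable 𝓘(ℝ, E) 𝓘(ℝ, ℝ) K) (hφ : MDifferentiable 𝓘(ℝ, E) 𝓘(ℝ, ℝ) φ)
    (h : ℝ) (g u : G) :
    (discreteLegendre (discreteLagrangian h K φ) g u : LieCoalg E) =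
      h • leftDifferential K u - (h / 2) • leftDifferential φ (g * u) := by
  have h1 := (mdifferentiableAt_comp_mul_left hK u 1).hasMFDerivAt
  have h2 := (mdifferentiableAt_comp_mul_left hφ (g * u) 1).hasMFDerivAt
  have h3 := ((h1.const_smul h).sub
    (hasMFDerivAt_const (I := 𝓘(ℝ, E)) (I' := 𝓘(ℝ, ℝ)) (h / 2 * φ g) (1 : G))).sub
      (h2.const_smul (h / 2))
  have h4 : (fun x : G => discreteLagrangian h K φ g (u * x)) =
      ((h • fun x => K (u * x)) - fun _ => h / 2 * φ g) - (h / 2) • fun x => φ (g * u * x) := by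
    funext x
    simp [discreteLagrangian, mul_assoc]
  rw [discreteLegendre, leftDifferential, h4, h3.mfderiv]
  exact congrArg (· - (h / 2) • (leftDifferential φ (g * u) : LieCoalg E))
    (sub_zero (h • (leftDifferential K u : LieCoalg E)))

/-- This is the discrete Euler–Lagrange equation: the derivatives of the actions before and after
the intermediate state balance. -/
theorem momentumSeq_succ_eq_of_isCriticalControl {K φ : G → ℝ}
    (hK : MDifferentiable 𝓘(ℝ, E) 𝓘(ℝ, ℝ) K) (hφ : MDifferentiable 𝓘(ℝ, E) 𝓘(ℝ, ℝ) φ)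
    {n : ℕ} {g₀ : G} {h : ℝ} {u : Fin n → G}
    (hu : IsCriticalControl E (actionSum g₀ h K φ) u) {k i : Fin n}
    (hki : k.succ = i.castSucc) :
    (momentumSeq g₀ h K φ u k.succ : LieCoalg E) =
      h • (coadjoint (u i)⁻¹ (leftDifferential K (u i)) +
        (1 / 2 : ℝ) • leftDifferential φ (stateSeq g₀ u i.castSucc)) := by
  have hne : k ≠ i := by
    rintro rfl
    simp [Fin.ext_iff] at hki
  set p : LieCoalg E := momentumSeq g₀ h K φ u k.succ with hp
  set q : LieCoalg E := h • (coadjoint (u i)⁻¹ (leftDifferential K (u i)) +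
        (1 / 2 : ℝ) • leftDifferential φ (stateSeq g₀ u i.castSucc)) with hq
  -- A one-sided inequality for both `a` and `-a` is an equality.
  suffices hle : ∀ a, 0 ≤ (p - q) a by
    ext a
    have h1 := hle a
    have h2 := hle (-a)
    rw [map_neg] at h2
    rw [sub_apply] at h1 h2
    linarith
  intro a
  obtain ⟨x, hx, hx0, hxd⟩ := exists_contMDiff_curve_through_one (G := G) a
  let c : ℝ → Fin n → G := fun t =>
    Function.update (Function.update u k (u k * x t)) i ((x t)⁻¹ * u i)
  have hc0 : c 0 = u := by simp [c, hx0]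
  refine nonneg_of_hasDerivAt_of_lowerDini_nonneg (J := actionSum g₀ h K φ) (c := c) ?_
    (hu c ?_ hc0)
  -- The summand `k` contributes `p a`, the summand `i` contributes `-q a`, and all others are
  -- constant.
  · have hterm : ∀ j : Fin n, HasDerivAt
        (fun t => discreteLagrangian h K φ (stateSeq g₀ (c t) j.castSucc) (c t j))
        ((if j = k then p a else 0) - (if j = i then q a else 0)) 0 := by
      intro j
      by_cases hji : j = i
      · subst hji
        rw [if_neg hne.symm, if_pos rfl]
        have e1 : ∀ t, discreteLagrangian h K φ (stateSeq g₀ (c t) j.castSucc) (c t j) =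
            h * K ((x t)⁻¹ * u j) - h / 2 * φ (stateSeq g₀ u j.castSucc * x t)
              - h / 2 * φ (stateSeq g₀ u j.castSucc * u j) := by
          intro t
          simp only [c, stateSeq_update_update g₀ (x t) u hki, if_true, discreteLagrangian,
            Function.update_self]
          rw [mul_assoc _ (x t), mul_inv_cancel_left]
        have hKinv : MDifferentiableAt 𝓘(ℝ, E) 𝓘(ℝ, ℝ) (fun y : G => K (y⁻¹ * u j)) 1 :=
          (mdifferentiableAt_comp_mul_right hK (u j) _).comp (1 : G)
            ((contMDiff_inv 𝓘(ℝ, E) ∞).mdifferentiable (by simp) 1)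
        have d1 : HasDerivAt (fun t => K ((x t)⁻¹ * u j))
            (-((coadjoint (u j)⁻¹ (leftDifferential K (u j)) : LieCoalg E) a)) 0 := by
          rw [coadjoint_inv_leftDifferential hK]
          exact (hxd _ hKinv).congr_deriv (mfderiv_comp_inv_one (f := fun y => K (y * u j))
            (mdifferentiableAt_comp_mul_right hK (u j)) a)
        have d2 : HasDerivAt (fun t => φ (stateSeq g₀ u j.castSucc * x t))
            ((leftDifferential φ (stateSeq g₀ u j.castSucc) : LieCoalg E) a) 0 :=
          hxd _ (mdifferentiableAt_comp_mul_left hφ (stateSeq g₀ u j.castSucc) 1)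
        simp only [e1]
        have hqa : q a = h * ((coadjoint (u j)⁻¹ (leftDifferential K (u j)) : LieCoalg E) a +
            1 / 2 * (leftDifferential φ (stateSeq g₀ u j.castSucc) : LieCoalg E) a) := rfl
        refine (((d1.const_mul h).sub (d2.const_mul (h / 2))).sub_const _).congr_deriv ?_
        rw [hqa]
        ring
      · have hjs : j.castSucc ≠ i.castSucc := fun h => hji (Fin.castSucc_injective n h)
        rw [if_neg hji, sub_zero]
        by_cases hjk : j = k
        · subst hjk
          rw [if_pos rfl]
          simp only [c, stateSeq_update_update _ _ u hki, if_neg hjs, Function.update_of_ne hji,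
            Function.update_self]
          exact hxd _ (mdifferentiableAt_comp_mul_left
            (mdifferentiable_discreteLagrangian hK hφ h (stateSeq g₀ u j.castSucc)) (u j) 1)
        · rw [if_neg hjk]
          simp only [c, stateSeq_update_update _ _ u hki, if_neg hjs, Function.update_of_ne hji,
            Function.update_of_ne hjk]
          exact hasDerivAt_const _ _
    have hsum := HasDerivAt.fun_sum (u := Finset.univ) fun j _ => hterm j
    simpa [actionSum, Finset.sum_sub_distrib] using hsum
  · intro j
    by_cases hji : j = i
    · subst hji
      simp only [c, Function.update_self]
      exact hx.inv.mul contMDiff_const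
    · by_cases hjk : j = k
      · subst hjk
        simp only [c, Function.update_of_ne hji, Function.update_self]
        exact contMDiff_const.mul hx
      · simp only [c, Function.update_of_ne hji, Function.update_of_ne hjk]
        exact contMDiff_const

/-- Critical controls satisfy the equations of the integrator. -/
theorem isIntegratorStep_of_isCriticalControl {K φ : G → ℝ}
    (hK : MDifferentiable 𝓘(ℝ, E) 𝓘(ℝ, ℝ) K) (hφ : MDifferentiable 𝓘(ℝ, E) 𝓘(ℝ, ℝ) φ)
    {n : ℕ} {g₀ : G} {h : ℝ} {u : Fin n → G}
    (hu : IsCriticalControl E (actionSum g₀ h K φ) u) {i : Fin n} (hi : 1 ≤ (i : ℕ)) :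
    IsIntegratorStep h K φ (stateSeq g₀ u i.castSucc)
      (momentumSeq g₀ h K φ u i.castSucc : LieCoalg E)
      (u i, stateSeq g₀ u i.succ, momentumSeq g₀ h K φ u i.succ) := by
  -- The variation needs a control preceding `u i`, which `1 ≤ i` supplies.
  obtain ⟨k, hki⟩ : ∃ k : Fin n, k.succ = i.castSucc :=
    ⟨⟨i - 1, by omega⟩, by ext; simp; omega⟩
  have h1 := momentumSeq_succ_eq_of_isCriticalControl hK hφ hu hki
  rw [hki] at h1
  refine ⟨h1, rfl, ?_⟩
  have h2 : (momentumSeq g₀ h K φ u i.succ : LieCoalg E) =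
      h • leftDifferential K (u i) - (h / 2) • leftDifferential φ (stateSeq g₀ u i.succ) :=
    discreteLegendre_discreteLagrangian hK hφ h _ _
  -- `Ad^*_u` turns the right differential of `K` back into the left one, and the terms in `m_i`
  -- cancel.
  rw [h1, h2, coadjoint_smul, coadjoint_add, coadjoint_coadjoint_inv, coadjoint_smul]
  module

end Criticality

/-! ### Unique solvability of a step -/

section Solvability

variable {E : Type*} [NormedAddCommGroup E] [NormedSpace ℝ E]
  {G : Type*} [TopologicalSpace G] [ChartedSpace E G] [Group G] [LieGroup 𝓘(ℝ, E) ∞ G]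

/-- Dividing by `h * s` moves `h`, `s` and the potential to the side of the data, which is why the
neighbourhoods can depend on `K` alone. -/
theorem momentum_eq_iff {K : G → ℝ} (hK : MDifferentiable 𝓘(ℝ, E) 𝓘(ℝ, ℝ) K) {h s : ℝ}
    (hh : 0 < h) (hs : 0 < s) (p m : LieCoalg E) (u : G) :
    p = h • (coadjoint u⁻¹ (leftDifferential (fun v => s * K v) u) + (1 / 2 : ℝ) • m) ↔
      (h * s)⁻¹ • (p - (h / 2) • m) = coadjoint u⁻¹ (leftDifferential K u) := by
  rw [leftDifferential_const_mul hK, coadjoint_smul, inv_smul_eq_iff₀ (mul_pos hh hs).ne',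
    sub_eq_iff_eq_add, smul_add, smul_smul, smul_smul, mul_one_div]

theorem existsUnique_isIntegratorStep {K φ : G → ℝ}
    (hK : MDifferentiable 𝓘(ℝ, E) 𝓘(ℝ, ℝ) K) {θ : OpenPartialHomeomorph G (LieCoalg E)}
    (hθ : ∀ u ∈ θ.source, θ u = coadjoint u⁻¹ (leftDifferential K u)) {h s : ℝ}
    (hh : 0 < h) (hs : 0 < s) (g : G) (p : LieCoalg E)
    (hp : (h * s)⁻¹ • (p - (h / 2) • leftDifferential φ g) ∈ θ.target) :
    ∃! x : G × G × LieCoalg E,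
      x.1 ∈ θ.source ∧ IsIntegratorStep h (fun v => s * K v) φ g p x := by
  set v := (h * s)⁻¹ • (p - (h / 2) • leftDifferential φ g) with hv
  have hu := θ.map_target hp
  refine ⟨(θ.symm v, g * θ.symm v, coadjoint (θ.symm v) p
    - (h / 2) • coadjoint (θ.symm v) (leftDifferential φ g)
    - (h / 2) • leftDifferential φ (g * θ.symm v)), ⟨hu, ?_, rfl, rfl⟩, ?_⟩
  · rw [momentum_eq_iff hK hh hs, ← hθ _ hu, θ.right_inv hp]
  · rintro ⟨y, g', p'⟩ ⟨hy, h1, h2, h3⟩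
    simp only at hy h1 h2 h3
    rw [momentum_eq_iff hK hh hs, ← hθ _ hy, ← hv] at h1
    obtain rfl : y = θ.symm v := by rw [h1, θ.left_inv hy]
    subst h2
    rw [h3]

/-- A known step with first component in `θ.source` already puts the rescaled momentum in
`θ.target`, so no smallness of the data has to be assumed. -/
theorem isIntegratorStep_iff_eq {K φ : G → ℝ}
    (hK : MDifferentiable 𝓘(ℝ, E) 𝓘(ℝ, ℝ) K) {θ : OpenPartialHomeomorph G (LieCoalg E)}
    (hθ : ∀ u ∈ θ.source, θ u = coadjoint u⁻¹ (leftDifferential K u)) {h s : ℝ}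
    (hh : 0 < h) (hs : 0 < s) {g : G} {p : LieCoalg E} {x₀ : G × G × LieCoalg E}
    (hx₀ : x₀.1 ∈ θ.source) (hstep : IsIntegratorStep h (fun v => s * K v) φ g p x₀)
    (x : G × G × LieCoalg E) :
    (x.1 ∈ θ.source ∧ IsIntegratorStep h (fun v => s * K v) φ g p x) ↔ x = x₀ := by
  refine ⟨fun hx => ?_, fun hx => hx ▸ ⟨hx₀, hstep⟩⟩
  refine (existsUnique_isIntegratorStep hK hθ hh hs g p ?_).unique hx ⟨hx₀, hstep⟩
  rw [(momentum_eq_iff hK hh hs _ _ _).1 hstep.1, ← hθ _ hx₀]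
  exact θ.map_source hx₀

end Solvability

/-! ### Small step sizes and the main theorem -/

theorem exists_forall_of_eventually_nhdsGT_zero {P : ℝ → Prop} (hP : ∀ᶠ h in 𝓝[>] 0, P h) :
    ∃ h₀ : ℝ, 0 < h₀ ∧ ∀ h : ℝ, 0 < h → h < h₀ → P h := by
  obtain ⟨h₀, hpos, hsub⟩ := mem_nhdsGT_iff_exists_Ioo_subset.1 hP
  exact ⟨h₀, hpos, fun h h1 h2 => hsub ⟨h1, h2⟩⟩

theorem mainTheorem11
    {E : Type*} [NormedAddCommGroup E] [NormedSpace ℝ E] [FiniteDimensional ℝ E]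
    {G : Type*} [TopologicalSpace G] [ChartedSpace E G] [Group G] [LieGroup 𝓘(ℝ, E) ∞ G]
    (K : G → ℝ) (hK : ContMDiff 𝓘(ℝ, E) 𝓘(ℝ, ℝ) 2 K)
    (hrank : DifferentialFullRankAtOne E K)
    (hzero : (leftDifferential K (1 : G) : LieCoalg E) = 0) :
    -- every critical control satisfies the equations of the integrator
    (∀ (φ : G → ℝ), ContMDiff 𝓘(ℝ, E) 𝓘(ℝ, ℝ) 2 φ →
      ∀ (n : ℕ) (g₀ : G) (h : ℝ), 0 < h → ∀ u : Fin n → G,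
      IsCriticalControl E (actionSum g₀ h K φ) u →
      ∀ i : Fin n, 1 ≤ (i : ℕ) →
        IsIntegratorStep h K φ (stateSeq g₀ u i.castSucc)
          (momentumSeq g₀ h K φ u i.castSucc : LieCoalg E)
          (u i, stateSeq g₀ u i.succ, momentumSeq g₀ h K φ u i.succ)) ∧
    -- unique solvability near the identity, with neighbourhoods that depend on `K` only
    ∃ (N : Set G) (V : Set (LieCoalg E)), IsOpen N ∧ 1 ∈ N ∧ IsOpen V ∧ 0 ∈ V ∧
      (∀ (φ : G → ℝ), ContMDiff 𝓘(ℝ, E) 𝓘(ℝ, ℝ) 2 φ →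
        ∀ (h s : ℝ), 0 < h → 0 < s → ∀ (g : G) (p : LieCoalg E),
        (h * s)⁻¹ • (p - (h / 2) • leftDifferential φ g) ∈ V →
        ∃! x : G × G × LieCoalg E,
          x.1 ∈ N ∧ IsIntegratorStep h (fun v => s * K v) φ g p x) ∧
      -- a step `u i ∈ N` of a critical control is recovered as the unique solution in `N`
      (∀ (φ : G → ℝ), ContMDiff 𝓘(ℝ, E) 𝓘(ℝ, ℝ) 2 φ →
        ∀ (n : ℕ) (g₀ : G) (h s : ℝ), 0 < h → 0 < s → ∀ u : Fin n → G,
        IsCriticalControl E (actionSum g₀ h (fun v => s * K v) φ) u →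
        ∀ i : Fin n, 1 ≤ (i : ℕ) → u i ∈ N →
        ∀ x : G × G × LieCoalg E,
          (x.1 ∈ N ∧ IsIntegratorStep h (fun v => s * K v) φ (stateSeq g₀ u i.castSucc)
            (momentumSeq g₀ h (fun v => s * K v) φ u i.castSucc) x) ↔
          x = (u i, stateSeq g₀ u i.succ,
            momentumSeq g₀ h (fun v => s * K v) φ u i.succ)) ∧
      -- small step sizes: solvability for given data
      (∀ (φ : G → ℝ), ContMDiff 𝓘(ℝ, E) 𝓘(ℝ, ℝ) 2 φ →
        ∀ s : ℝ → ℝ, (∀ᶠ h in 𝓝[>] 0, 0 < s h) → ∀ (g : ℝ → G) (p : ℝ → LieCoalg E),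
        Tendsto (fun h : ℝ => (h * s h)⁻¹ • (p h - (h / 2) • leftDifferential φ (g h)))
          (𝓝[>] 0) (𝓝 0) →
        ∃ h₀ : ℝ, 0 < h₀ ∧ ∀ h : ℝ, 0 < h → h < h₀ →
          ∃! x : G × G × LieCoalg E,
            x.1 ∈ N ∧ IsIntegratorStep h (fun v => s h * K v) φ (g h) (p h) x) ∧
      -- small step sizes: critical controls
      (∀ (φ : G → ℝ), ContMDiff 𝓘(ℝ, E) 𝓘(ℝ, ℝ) 2 φ →
        ∀ s : ℝ → ℝ, (∀ᶠ h in 𝓝[>] 0, 0 < s h) → ∀ (n : ℕ) (g₀ : G) (u : ℝ → Fin n → G),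
        (∀ᶠ h in 𝓝[>] 0, IsCriticalControl E (actionSum g₀ h (fun v => s h * K v) φ) (u h)) →
        ∀ i : Fin n, 1 ≤ (i : ℕ) → Tendsto (fun h => u h i) (𝓝[>] 0) (𝓝 1) →
        ∃ h₀ : ℝ, 0 < h₀ ∧ ∀ h : ℝ, 0 < h → h < h₀ →
          ∀ x : G × G × LieCoalg E,
            (x.1 ∈ N ∧ IsIntegratorStep h (fun v => s h * K v) φ (stateSeq g₀ (u h) i.castSucc)
              (momentumSeq g₀ h (fun v => s h * K v) φ (u h) i.castSucc) x) ↔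
            x = (u h i, stateSeq g₀ (u h) i.succ,
              momentumSeq g₀ h (fun v => s h * K v) φ (u h) i.succ)) := by
  have hKd : MDifferentiable 𝓘(ℝ, E) 𝓘(ℝ, ℝ) K := hK.mdifferentiable (by simp)
  have hsK : ∀ s : ℝ, MDifferentiable 𝓘(ℝ, E) 𝓘(ℝ, ℝ) (fun v => s * K v) :=
    fun s g => (hKd g).const_smul s
  refine ⟨fun φ hφ n g₀ h _ u hu i hi =>
    isIntegratorStep_of_isCriticalControl hKd (hφ.mdifferentiable (by simp)) hu hi, ?_⟩
  obtain ⟨θ, h1, h0, hθ⟩ :=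
    exists_openPartialHomeomorph_coadjoint_leftDifferential hK hrank hzero
  have hcrit : ∀ (φ : G → ℝ), ContMDiff 𝓘(ℝ, E) 𝓘(ℝ, ℝ) 2 φ →
      ∀ (n : ℕ) (g₀ : G) (h s : ℝ), 0 < h → 0 < s → ∀ u : Fin n → G,
      IsCriticalControl E (actionSum g₀ h (fun v => s * K v) φ) u →
      ∀ i : Fin n, 1 ≤ (i : ℕ) → u i ∈ θ.source →
      ∀ x : G × G × LieCoalg E,
        (x.1 ∈ θ.source ∧ IsIntegratorStep h (fun v => s * K v) φ (stateSeq g₀ u i.castSucc)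
          (momentumSeq g₀ h (fun v => s * K v) φ u i.castSucc) x) ↔
        x = (u i, stateSeq g₀ u i.succ,
          momentumSeq g₀ h (fun v => s * K v) φ u i.succ) :=
    fun φ hφ n g₀ h s hh hs u hu i hi hui => isIntegratorStep_iff_eq hKd hθ hh hs hui
      (isIntegratorStep_of_isCriticalControl (hsK s) (hφ.mdifferentiable (by simp)) hu hi)
  refine ⟨θ.source, θ.target, θ.open_source, h1, θ.open_target, h0,
    fun φ _ h s hh hs g p => existsUnique_isIntegratorStep hKd hθ hh hs g p, hcrit, ?_, ?_⟩
  · intro φ _ s hs g p hlim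
    refine exists_forall_of_eventually_nhdsGT_zero ?_
    -- The target is a fixed neighbourhood of `0`, independent of `h`, so convergence of the
    -- rescaled momentum to `0` suffices.
    filter_upwards [hs, hlim.eventually (θ.open_target.mem_nhds h0), self_mem_nhdsWithin]
      with h hsh hmem hh
    exact existsUnique_isIntegratorStep hKd hθ hh hsh (g h) (p h) hmem
  · intro φ hφ s hs n g₀ u hu i hi hlim
    refine exists_forall_of_eventually_nhdsGT_zero ?_
    filter_upwards [hs, hu, hlim.eventually (θ.open_source.mem_nhds h1), self_mem_nhdsWithin]
      with h hsh huh hmem hh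
    exact hcrit φ hφ n g₀ h (s h) hh hsh (u h) huh i hi hmem
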